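/- A *hypergraph* $\mathbb H$ consists of a set $V(\mathbb H)$ of hypervertices and a family $E(\mathbb H)$ of nonempty subsets $e\subseteq V(\mathbb H)$ (hyperedges, repetitions allowed) whose union is $V(\mathbb H)$. A *closed path* of length $k\ge 1$ in $\mathbb H$ is a sequence $c=(v_1,e_1,v_2,e_2,\dots,v_k,e_k,v_1)$ such that, for all $i\in\mathbb Z/k\mathbb Z$, $v_i$ and $v_{i+1}$ are distinct elements of $e_i$. It has *backtracking* if some $(e,v,e)$ occurs in it as consecutive terms. A *graph* $X$ may have loops and parallel edges; loops count twice in vertex degrees. A closed path of length $k\ge1$ in $X$ is a sequence of $k$ oriented edges, each beginning where the (cyclically) preceding one ends; it has backtracking if it contains an oriented edge directly followed by its inverse. (Each edge, loops included, has two orientations, inverse to each other.) In both settings let $c^m$ denote the closed path that goes around $c$ $m$ times. A *primitive cycle* is a closed path $c$ such that neither $c$ nor $c^2$ has backtracking and $c\ne b^m$ for all closed paths $b$ and all $m\ge2$; a *prime cycle* $\mathfrak p$ is a class of primitive cycles under cyclic permutation, and $|\mathfrak p|$ is its length. For $u\in\mathbb C$ with $|u|$ sufficiently small, the zeta functions $\zeta_{\mathbb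 H}(u)$ of a finite hypergraph and $Z_X(u)$ of a finite graph are the products $\prod_{\mathfrak p}(1-u^{|\mathfrak p|})^{-1}$ over all prime cycles of $\mathbb H$ and of $X$, respectively. **Proposition.** 1. Let $X$ be a finite graph with no vertex of degree $1$. Then, for $|u|$ sufficiently small, the product defining $Z_X(u)$ converges to a nonzero number, and $Z_X(u)^{-1}$ is given by a unique polynomial in $u$; this polynomial has degree $2|E(X)|$. 2. Let $\mathbb H$ be a finite hypergraph in which every hypervertex lies in at least two hyperedges and every hyperedge contains at least two hypervertices. Then, for $|u|$ sufficiently small, the product defining $\zeta_{\mathbb H}(u)$ converges to a nonzero number, and $\zeta_{\mathbb H}(u)^{-1}$ is given by a unique polynomial in $u$; this polynomial has degree $\sum_{e\in E(\mathbb H)}|e|$. 3. Hence, if $\mathbb H$ is as in 2 and $\sum_{e\in E(\mathbb H)}|e|$ is odd, then $\zeta_{\mathbb H}$ is not the zeta function of any graph: for every finite graph $X$ (vertices of degree $1$ allowed), $\zeta_{\mathbb H}(u)$ and $Z_X(u)$ do not agree on any neighbourhood of $u=0$. -/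

import Mathlib

open scoped Polynomial

namespace HypergraphZeta

/-! ### Prime cycles and Euler products

A closed path is recorded by the list of its steps. For a hypergraph the closed path
`(v₁, e₁, v₂, e₂, …, v_k, e_k, v₁)` is the list `[(v₁, e₁), …, (v_k, e_k)]`; for a graph it is
the list of the oriented edges traversed. The two notions of zeta function differ only in what
it means for one step to follow another and for two successive steps to backtrack. -/

/-- The data that closed paths and backtracking depend on: `follows a b` says that step `b` may
come directly after step `a`, and `backtracks a b` says that `a`, directly followed by `b`, is a
backtracking. -/
structure StepRule (α : Type*) where
  follows : α → α → Prop
  backtracks : α → α → Prop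

namespace StepRule

variable {α : Type*} (S : StepRule α)

/-- A closed path of length `k = l.length ≥ 1`: each step follows the preceding one, cyclically. -/
def IsClosedPath (l : List α) : Prop :=
  l ≠ [] ∧ (l : Cycle α).Chain S.follows

/-- Some two successive steps of the sequence `l` (not read cyclically) backtrack. -/
def HasBacktracking (l : List α) : Prop :=
  ∃ (l₁ l₂ : List α) (a b : α), l = l₁ ++ a :: b :: l₂ ∧ S.backtracks a b

/-- The `m`-multiple of `l`: go around `l` a number `m` of times. -/
def multiple (m : ℕ) (l : List α) : List α :=
  (List.replicate m l).flatten

/-- `l` is tail-less if its `2`-multiple has no backtracking. -/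
def IsTailless (l : List α) : Prop :=
  ¬ S.HasBacktracking (multiple 2 l)

/-- A primitive cycle: a closed path without backtracking, tail-less, and not a non-trivial
multiple of a closed path. -/
def IsPrimitive (l : List α) : Prop :=
  S.IsClosedPath l ∧ ¬ S.HasBacktracking l ∧ S.IsTailless l ∧
    ¬ ∃ (m : ℕ) (b : List α), 2 ≤ m ∧ S.IsClosedPath b ∧ l = multiple m b

/-- The prime cycles: the classes of primitive cycles under cyclic permutation
(`Cycle α` is the quotient of `List α` by cyclic permutation). -/
def PrimeCycle : Type _ :=
  {c : Cycle α // ∃ l : List α, S.IsPrimitive l ∧ (l : Cycle α) = c}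

/-- The length of a prime cycle. -/
def PrimeCycle.length {S : StepRule α} (c : S.PrimeCycle) : ℕ :=
  Cycle.length c.1

/-- The Euler product `∏ (1 - u ^ |𝔭|)⁻¹` over all prime cycles `𝔭`. -/
noncomputable def zeta (u : ℂ) : ℂ :=
  ∏' c : S.PrimeCycle, (1 - u ^ c.length)⁻¹

/-- The inverse of the zeta function is the polynomial `p`: for all sufficiently small `u` the
Euler product converges (unconditionally) to a nonzero number, whose inverse is `p(u)`. -/
def InvZetaIs (p : ℂ[X]) : Prop :=
  ∃ r : ℝ, 0 < r ∧ ∀ u : ℂ, ‖u‖ < r →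
    Multipliable (fun c : S.PrimeCycle => (1 - u ^ c.length)⁻¹) ∧
      S.zeta u ≠ 0 ∧ (S.zeta u)⁻¹ = p.eval u

end StepRule

/-! ### Hypergraphs -/

/-- A hypergraph with hypervertices `V` and hyperedges indexed by `E`: each hyperedge is a
nonempty finite set of hypervertices, hyperedges may repeat, and they cover `V`. -/
structure MultiHypergraph (V E : Type*) where
  edge : E → Finset V
  nonempty : ∀ e, (edge e).Nonempty
  cover : ∀ v, ∃ e, v ∈ edge e

namespace MultiHypergraph

variable {V E : Type*} (H : MultiHypergraph V E)

/-- The step `(v, e)` leaves the hypervertex `v` through the hyperedge `e`. It is followed by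
`(w, f)` if `v` and `w` are distinct hypervertices of `e`; using the same hyperedge in both
steps is hyperedge backtracking. -/
def stepRule : StepRule (V × E) where
  follows a b := a.1 ∈ H.edge a.2 ∧ b.1 ∈ H.edge a.2 ∧ a.1 ≠ b.1
  backtracks a b := a.2 = b.2

/-- The generalized Ihara–Selberg zeta function of a hypergraph. -/
noncomputable def zeta (u : ℂ) : ℂ := H.stepRule.zeta u

/-- The number of hyperedges (counted with repetition) that contain `v`. -/
noncomputable def degree (v : V) : ℕ := {e : E | v ∈ H.edge e}.ncard

end MultiHypergraph

/-! ### Graphs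

Graphs are Mathlib's `Graph`, which may have loops and parallel edges. -/

section Graphs

variable {α β : Type*} (G : Graph α β)

/-- The degree of a vertex; a loop counts twice. -/
noncomputable def graphDegree (v : α) : ℕ :=
  {e : β | G.Inc e v}.ncard + (G.loopSet v).ncard

/-- The origin of the edge `e` in an arbitrary orientation, fixed once and for all. -/
noncomputable def edgeOrigin (e : G.edgeSet) : α :=
  (G.exists_isLink_of_mem_edgeSet e.2).choose

/-- The terminus of the edge `e` in the same orientation. -/
noncomputable def edgeTerminus (e : G.edgeSet) : α :=
  (G.exists_isLink_of_mem_edgeSet e.2).choose_spec.choose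

theorem isLink_edgeOrigin_edgeTerminus (e : G.edgeSet) :
    G.IsLink e (edgeOrigin G e) (edgeTerminus G e) :=
  (G.exists_isLink_of_mem_edgeSet e.2).choose_spec.choose_spec

/-- The oriented edges: every edge of `G` in both of its directions. The edge `e` itself is
`(e, true)` and its inverse is `(e, false)`; these differ also if `e` is a loop. -/
abbrev OrientedEdge : Type _ := G.edgeSet × Bool

/-- The origin of an oriented edge. -/
noncomputable def OrientedEdge.origin {G : Graph α β} (a : OrientedEdge G) : α :=
  if a.2 then edgeOrigin G a.1 else edgeTerminus G a.1

/-- The terminus of an oriented edge. -/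
noncomputable def OrientedEdge.terminus {G : Graph α β} (a : OrientedEdge G) : α :=
  if a.2 then edgeTerminus G a.1 else edgeOrigin G a.1

/-- The inverse of an oriented edge. -/
def OrientedEdge.inverse {G : Graph α β} (a : OrientedEdge G) : OrientedEdge G :=
  (a.1, !a.2)

/-- An oriented edge is followed by one that starts where it ends; backtracking is to traverse
an oriented edge and directly afterwards its inverse. -/
noncomputable def graphStepRule : StepRule (OrientedEdge G) where
  follows a b := a.terminus = b.origin
  backtracks a b := b = a.inverse

/-- The Ihara–Selberg zeta function of a graph. -/
noncomputable def graphZeta (u : ℂ) : ℂ := (graphStepRule G).zeta u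

end Graphs

end HypergraphZeta

open HypergraphZeta

/-!
Both zeta functions are Euler products over the prime cycles of a finite set of steps, and both are
treated at once. Let `T` be the 0-1 matrix recording which step may follow which without
backtracking (`StepRule.transfer`). The key fact is the determinant formula
`StepRule.invZetaIs_charpolyRev`: near `u = 0` the Euler product converges, and its inverse is
`det (1 - uT)`, the reversed characteristic polynomial of `T`.

To prove it, sum `u ^ |l| / |l|` over all closed non-backtracking words `l` in two ways. By length,
the words of length `n` number `tr T ^ n = ∑ λ ^ n`, the sum being over the eigenvalues of `T`
(`card_closedWord`, `trace_pow_eq_sum_roots`), so the total is `-∑ log (1 - λu)`, which is minus a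
logarithm of `det (1 - uT)`. On the other hand every such word is uniquely a multiple of a
primitive one (`StepRule.bijective_multiple`), and a prime cycle of length `d` consists of exactly
`d` primitive words (`StepRule.card_isPrimitive_of_primeCycle`), so the total is
`-∑ log (1 - u ^ |𝔭|)`, a logarithm of the Euler product. The combinatorics of words is reduced to
least periods of the shift map: a word is primitive exactly when its length is the least period of
the periodic sequence it generates.

The degree of `det (1 - uT)` is the size of `T` when `T` is invertible. For a graph, `T` is up to a
permutation of its rows block diagonal, with one block for each vertex, the all-ones matrix minus
the identity of size the degree of the vertex; such a block is singular only in size one. For a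
hypergraph, `T` restricted to the incident pairs is a product of two matrices of this kind, one
with blocks given by the hyperedges, the other by the hypervertices.

For an arbitrary finite graph, an edge with an end of degree one contributes only a zero row and a
zero column and can be removed without changing `det (1 - uT)`. When no such edge is left, the
degree is twice the number of remaining edges. Hence it is always even, while it is odd for a
hypergraph with `∑ |e|` odd.
-/

namespace HypergraphZeta

/-! ### Eigenvalues and the reversed characteristic polynomial -/

section Matrices

open Polynomial Matrix

variable {n : Type*} [Fintype n] [DecidableEq n]

theorem eval_charpoly_eq_prod_roots (A : Matrix n n ℂ) (z : ℂ) :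
    A.charpoly.eval z = (A.charpoly.roots.map (fun x => z - x)).prod := by
  conv_lhs => rw [(IsAlgClosed.splits A.charpoly).eq_prod_roots_of_monic A.charpoly_monic]
  rw [eval_multiset_prod, Multiset.map_map]
  simp

/-- Spectral mapping for determinants: if the `λᵢ` are the eigenvalues of `A` with multiplicity,
then `det p(A) = ∏ p(λᵢ)`. -/
theorem det_aeval_eq_prod_roots (A : Matrix n n ℂ) (p : ℂ[X]) :
    (aeval A p).det = (A.charpoly.roots.map (fun x => p.eval x)).prod := by
  have hcard : A.charpoly.roots.card = Fintype.card n := by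
    rw [← (IsAlgClosed.splits A.charpoly).natDegree_eq_card_roots, A.charpoly_natDegree_eq_dim]
  -- `p` is a product of constants and of factors `X + C a`, for which the claim is about `charpoly`.
  refine Submonoid.closure_induction ?_ ?_ ?_ (IsAlgClosed.splits p)
  · rintro _ (⟨a, rfl⟩ | ⟨a, rfl⟩)
    · simp [Matrix.algebraMap_eq_diagonal, hcard]
    · have h := eval_charpoly_eq_prod_roots A (-a)
      rw [Matrix.eval_charpoly, ← neg_sub, det_neg] at h
      have h' : (aeval A) (X + C a) = A - scalar n (-a) := by
        simp [Matrix.algebraMap_eq_diagonal, Pi.algebraMap_def, ← Matrix.diagonal_neg]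
      have h2 : (-1 : ℂ) ^ Fintype.card n * (-1) ^ Fintype.card n = 1 := by
        rw [← mul_pow]; simp
      have h3 : (A.charpoly.roots.map fun x => -a - x) =
          (A.charpoly.roots.map fun x => eval x (X + C a)).map Neg.neg := by
        rw [Multiset.map_map]
        refine Multiset.map_congr rfl fun x _ => ?_
        simp
        ring
      rw [h3, Multiset.prod_map_neg, Multiset.card_map, hcard] at h
      rw [h', ← one_mul (det _), ← h2, mul_assoc, h, ← mul_assoc, h2, one_mul]
  · simp
  · intro p q _ _ hp hq
    simp [hp, hq, Multiset.prod_map_mul]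

theorem trace_pow_eq_sum_roots (A : Matrix n n ℂ) (m : ℕ) :
    (A ^ m).trace = (A.charpoly.roots.map (fun x => x ^ m)).sum := by
  have h : (A ^ m).charpoly = ((A.charpoly.roots.map (fun x => x ^ m)).map (X - C ·)).prod := by
    refine Polynomial.funext fun z => ?_
    -- `det (z - A ^ m)` is the determinant of the polynomial `z - X ^ m` in `A`.
    have h1 := det_aeval_eq_prod_roots A (C z - X ^ m)
    rw [Matrix.eval_charpoly, eval_multiset_prod, Multiset.map_map, Multiset.map_map]
    simpa [Matrix.algebraMap_eq_diagonal, Pi.algebraMap_def, Function.comp_def] using h1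
  rw [Matrix.trace_eq_sum_roots_charpoly, h, roots_multiset_prod_X_sub_C]

theorem eval_charpolyRev_eq_det (A : Matrix n n ℂ) (u : ℂ) :
    A.charpolyRev.eval u = (1 - u • A).det := by
  rw [charpolyRev, ← coe_evalRingHom, RingHom.map_det]
  congr 1
  ext i j
  rcases eq_or_ne i j with h | h <;> simp [h] <;> ring

theorem eval_charpolyRev_eq_prod_roots (A : Matrix n n ℂ) (u : ℂ) :
    A.charpolyRev.eval u = (A.charpoly.roots.map (fun x => 1 - u * x)).prod := by
  have h := det_aeval_eq_prod_roots A (1 - C u * X)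
  rw [eval_charpolyRev_eq_det]
  simpa [Algebra.smul_def] using h

/-- If the rows of `A` outside `p` vanish, then these rows do not contribute to `det (1 - uA)`. -/
theorem charpolyRev_of_rows_eq_zero (A : Matrix n n ℂ) (p : n → Prop) [DecidablePred p]
    (h : ∀ i, ¬ p i → ∀ j, A i j = 0) :
    A.charpolyRev = (A.toSquareBlockProp p).charpolyRev := by
  unfold charpolyRev
  rw [twoBlockTriangular_det _ p]
  · have h2 : (toSquareBlockProp (1 - (X : ℂ[X]) • A.map C) fun i => ¬ p i) = 1 := by
      ext i j
      simp [toSquareBlockProp, h i.1 i.2, Matrix.one_apply, Subtype.ext_iff]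
    rw [h2, det_one, mul_one]
    congr 1
    ext i j
    simp [toSquareBlockProp, Matrix.one_apply, Subtype.ext_iff]
  · intro i hi j hj
    have : i ≠ j := fun e => hi (e ▸ hj)
    simp [h i hi, this]

theorem charpolyRev_transpose (A : Matrix n n ℂ) : Aᵀ.charpolyRev = A.charpolyRev := by
  rw [← reverse_charpoly, ← reverse_charpoly, charpoly_transpose]

theorem charpolyRev_congr_rows {A B : Matrix n n ℂ}
    (p : n → Prop) (hA : ∀ i, ¬ p i → ∀ j, A i j = 0) (hB : ∀ i, ¬ p i → ∀ j, B i j = 0)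
    (h : ∀ i j, p i → p j → A i j = B i j) : A.charpolyRev = B.charpolyRev := by
  classical
  rw [charpolyRev_of_rows_eq_zero A p hA, charpolyRev_of_rows_eq_zero B p hB]
  congr 1
  ext i j
  exact h i.1 j.1 i.2 j.2

theorem charpolyRev_congr_cols {A B : Matrix n n ℂ}
    (p : n → Prop) (hA : ∀ j, ¬ p j → ∀ i, A i j = 0) (hB : ∀ j, ¬ p j → ∀ i, B i j = 0)
    (h : ∀ i j, p i → p j → A i j = B i j) : A.charpolyRev = B.charpolyRev := by
  rw [← charpolyRev_transpose A, ← charpolyRev_transpose B]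
  exact charpolyRev_congr_rows p hA hB fun i j hi hj => h j i hj hi

theorem natDegree_charpolyRev_of_mulVec_injective (A : Matrix n n ℂ)
    (h : ∀ x : n → ℂ, A *ᵥ x = 0 → x = 0) : A.charpolyRev.natDegree = Fintype.card n := by
  have hd : A.det ≠ 0 := fun h0 => by
    obtain ⟨v, hv, hv'⟩ := exists_mulVec_eq_zero_iff.2 h0
    exact hv (h v hv')
  have hc : A.charpoly.coeff 0 ≠ 0 := by
    intro h0
    rw [det_eq_sign_charpoly_coeff, h0, mul_zero] at hd
    exact hd rfl
  rw [← reverse_charpoly, reverse_natDegree, natTrailingDegree_eq_zero.2 (Or.inr hc),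
    charpoly_natDegree_eq_dim, Nat.sub_zero]

end Matrices

/-! ### Periodic sequences and primitive words -/

section Words

open Function StepRule

variable {α : Type*}

/-- The shift on one-sided sequences. -/
def shift {γ : Type*} (g : ℕ → γ) : ℕ → γ := fun n => g (n + 1)

theorem shift_iterate {γ : Type*} (k : ℕ) (g : ℕ → γ) (n : ℕ) : shift^[k] g n = g (n + k) := by
  induction k generalizing g with
  | zero => rfl
  | succ k ih => rw [iterate_succ_apply, ih]; simp [shift, add_assoc]

theorem isPeriodicPt_shift_iff {γ : Type*} {k : ℕ} {g : ℕ → γ} :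
    IsPeriodicPt shift k g ↔ ∀ n, g (n + k) = g n := by
  simp [IsPeriodicPt, IsFixedPt, funext_iff, shift_iterate]

/-- The sequence obtained by reading the word `l` periodically. Its values are `Option`s so that
the empty word needs no separate treatment: it gives the constant sequence `none`. -/
def unroll (l : List α) : ℕ → Option α := fun n => l[n % l.length]?

theorem unroll_of_lt {l : List α} {n : ℕ} (h : n < l.length) : unroll l n = some l[n] := by
  simp [unroll, Nat.mod_eq_of_lt h, h]

theorem unroll_mod (l : List α) (n : ℕ) : unroll l (n % l.length) = unroll l n := by
  simp [unroll]

theorem isPeriodicPt_unroll (l : List α) : IsPeriodicPt shift l.length (unroll l) :=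
  isPeriodicPt_shift_iff.2 fun n => by simp [unroll]

theorem unroll_mem_periodicPts {l : List α} (h : l ≠ []) : unroll l ∈ periodicPts shift :=
  ⟨l.length, List.length_pos_of_ne_nil h, isPeriodicPt_unroll l⟩

theorem eq_of_unroll_eq {l l' : List α} (h : unroll l = unroll l') (hl : l.length = l'.length) :
    l = l' :=
  List.ext_getElem hl fun n h₁ h₂ => by
    have := congrFun h n
    rwa [unroll_of_lt h₁, unroll_of_lt h₂, Option.some_inj] at this

theorem unroll_rotate (l : List α) (k : ℕ) : unroll (l.rotate k) = shift^[k] (unroll l) := by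
  funext n
  rw [shift_iterate]
  rcases eq_or_ne l [] with rfl | h
  · simp [unroll]
  · have := Nat.mod_lt n (List.length_pos_of_ne_nil h)
    simp [unroll, this]

theorem multiple_succ (k : ℕ) (l : List α) : multiple (k + 1) l = l ++ multiple k l := by
  simp [multiple, List.replicate_succ]

@[simp] theorem multiple_one (l : List α) : multiple 1 l = l := by simp [multiple]

@[simp] theorem length_multiple (k : ℕ) (l : List α) : (multiple k l).length = k * l.length := by
  simp [multiple]

theorem getElem?_multiple (k : ℕ) (l : List α) (n : ℕ) (h : n < k * l.length) :
    (multiple k l)[n]? = unroll l n := by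
  induction k generalizing n with
  | zero => simp at h
  | succ k ih =>
    rw [multiple_succ]
    rcases lt_or_ge n l.length with hn | hn
    · rw [List.getElem?_append_left hn, unroll_of_lt hn, List.getElem?_eq_getElem hn]
    · rw [List.getElem?_append_right hn, ih _ (by rw [add_mul] at h; omega), unroll, unroll]
      conv_rhs => rw [← Nat.sub_add_cancel hn]
      simp

theorem unroll_multiple {k : ℕ} (hk : k ≠ 0) (l : List α) : unroll (multiple k l) = unroll l := by
  funext n
  rcases eq_or_ne l [] with rfl | h
  · simp [unroll, multiple]
  · have h0 : 0 < k * l.length := Nat.mul_pos (Nat.pos_of_ne_zero hk) (List.length_pos_of_ne_nil h)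
    have := Nat.mod_lt n h0
    rw [unroll, length_multiple, getElem?_multiple _ _ _ this, unroll, unroll,
      Nat.mod_mul_left_mod]

/-- A word whose unrolling has a period `d` dividing its length is a multiple of its prefix of
length `d`. -/
theorem eq_multiple_take {l : List α} {d k : ℕ} (hl : l ≠ []) (hd : IsPeriodicPt shift d (unroll l))
    (hk : l.length = k * d) : l = multiple k (l.take d) := by
  have hpos := List.length_pos_of_ne_nil hl
  have hk0 : k ≠ 0 := by rintro rfl; simp at hk; exact hl hk
  have hle : d ≤ l.length := hk ▸ Nat.le_mul_of_pos_left d (Nat.pos_of_ne_zero hk0)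
  have hd0 : 0 < d := Nat.pos_of_ne_zero (by rintro rfl; simp at hk; exact hl hk)
  have hlen : (l.take d).length = d := by simpa using hle
  refine eq_of_unroll_eq ?_ (by rw [length_multiple, hlen, hk])
  rw [unroll_multiple hk0]
  funext n
  have h2 : unroll l (n % d) = unroll l n := by
    conv_rhs => rw [← Nat.mod_add_div n d, mul_comm]
    exact ((isPeriodicPt_shift_iff.1 (hd.const_mul (n / d))) (n % d)).symm
  have hlt := Nat.mod_lt n hd0
  rw [← h2, unroll_of_lt (hlt.trans_le hle), ← unroll_mod, hlen,
    unroll_of_lt (by rw [hlen]; exact hlt)]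
  simp

/-- A word that is not a proper multiple is the one whose length is the least period of its
unrolling. -/
theorem minimalPeriod_unroll_eq_length_iff {l : List α} (hl : l ≠ []) :
    minimalPeriod shift (unroll l) = l.length ↔
      ∀ (m : ℕ) (b : List α), 2 ≤ m → l ≠ multiple m b := by
  constructor
  · -- A proper multiple of `b` has the period `b.length`, less than its own length.
    rintro h m b hm rfl
    rw [unroll_multiple (by omega), length_multiple] at h
    have hb : b ≠ [] := by rintro rfl; simp [multiple] at hl
    have hb' := List.length_pos_of_ne_nil hb
    have := (isPeriodicPt_unroll b).minimalPeriod_le hb'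
    rw [h] at this
    nlinarith
  · intro h
    obtain ⟨k, hk⟩ := (isPeriodicPt_unroll l).minimalPeriod_dvd
    rw [mul_comm] at hk
    have hl' := List.length_pos_of_ne_nil hl
    have := eq_multiple_take hl (isPeriodicPt_minimalPeriod _ _) hk
    by_contra hne
    refine h k _ ?_ this
    rcases k with _ | _ | k
    · simp at hk; exact absurd hk hl
    · simp at hk; exact absurd hk.symm hne
    · omega

/-- A finite stretch `w` of the unrolling of `l` that is longer than `l` contains all pairs of
cyclically successive letters of `l`. -/
theorem isChain_iff_unroll {R : α → α → Prop} {l w : List α} (hlen : l.length < w.length)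
    (hw : ∀ i < w.length, w[i]? = unroll l i) :
    List.IsChain R w ↔ ∀ i, ∀ a ∈ unroll l i, ∀ b ∈ unroll l (i + 1), R a b := by
  rw [List.isChain_iff_getElem]
  have key : ∀ i (h : i < w.length), unroll l i = some w[i] := fun i h => by
    rw [← hw i h, List.getElem?_eq_getElem h]
  constructor
  · intro h i a ha b hb
    have hl : 0 < l.length := by
      rcases l with _ | _
      · simp [unroll] at ha
      · simp
    have hlt : i % l.length < l.length := Nat.mod_lt _ hl
    have hb' : unroll l (i % l.length + 1) = some b := by
      rw [← unroll_mod, Nat.mod_add_mod, unroll_mod]; exact hb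
    rw [Option.mem_def, ← unroll_mod] at ha
    have hlt' : i % l.length + 1 < w.length := by omega
    rw [key _ (by omega)] at ha
    rw [key _ hlt'] at hb'
    have := h _ hlt'
    simp only [Option.some_inj] at ha hb'
    rwa [ha, hb'] at this
  · intro h i hi
    exact h i _ (key _ (by omega)) _ (key _ hi)

theorem cycle_chain_iff_unroll {R : α → α → Prop} {l : List α} :
    (l : Cycle α).Chain R ↔ ∀ i, ∀ a ∈ unroll l i, ∀ b ∈ unroll l (i + 1), R a b := by
  rcases l with _ | ⟨x, l⟩
  · simp [unroll]
  · rw [Cycle.chain_coe_cons]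
    refine isChain_iff_unroll (by simp) fun i h => ?_
    rw [← List.cons_append] at h ⊢
    rcases lt_or_ge i (x :: l).length with hi | hi
    · rw [List.getElem?_append_left hi, unroll_of_lt hi, List.getElem?_eq_getElem hi]
    · have : i = (x :: l).length := by
        rw [List.length_append, List.length_singleton] at h
        omega
      subst this
      simp [unroll]

theorem cycle_chain_multiple_iff {R : α → α → Prop} {l : List α} {k : ℕ} (hk : k ≠ 0) :
    ((multiple k l : List α) : Cycle α).Chain R ↔ (l : Cycle α).Chain R := by
  rw [cycle_chain_iff_unroll, cycle_chain_iff_unroll, unroll_multiple hk]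

/-- A relation holds along the doubled word exactly when it holds cyclically along the word. -/
theorem isChain_multiple_two_iff {R : α → α → Prop} {l : List α} :
    List.IsChain R (multiple 2 l) ↔ (l : Cycle α).Chain R := by
  rcases eq_or_ne l [] with rfl | h
  · simp [multiple]
  · have hl := List.length_pos_of_ne_nil h
    rw [cycle_chain_iff_unroll]
    refine isChain_iff_unroll (by rw [length_multiple]; omega) fun i hi => ?_
    exact getElem?_multiple 2 l i (by simpa using hi)

/-! ### Non-backtracking steps -/

namespace StepRule

variable (S : StepRule α)

/-- `b` may follow `a` without backtracking. -/
def Next (a b : α) : Prop := S.follows a b ∧ ¬ S.backtracks a b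

theorem not_hasBacktracking_iff (l : List α) :
    ¬ S.HasBacktracking l ↔ List.IsChain (fun a b => ¬ S.backtracks a b) l := by
  rw [List.isChain_iff_forall_rel_of_append_cons_cons, HasBacktracking]
  constructor
  · intro h a b l₁ l₂ e hb
    exact h ⟨l₁, l₂, a, b, e, hb⟩
  · rintro h ⟨l₁, l₂, a, b, e, hb⟩
    exact h e hb

/-- Being a closed path without backtracking or tail, and not a proper multiple, amounts to being a
non-empty cyclic chain for `Next` whose unrolling has no shorter period. -/
theorem isPrimitive_iff (l : List α) :
    S.IsPrimitive l ↔ l ≠ [] ∧ (l : Cycle α).Chain S.Next ∧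
      minimalPeriod shift (unroll l) = l.length := by
  have h1 : (l : Cycle α).Chain S.Next ↔
      (l : Cycle α).Chain S.follows ∧ (l : Cycle α).Chain (fun a b => ¬ S.backtracks a b) := by
    simp only [cycle_chain_iff_unroll, Next]
    exact ⟨fun h => ⟨fun i a ha b hb => (h i a ha b hb).1, fun i a ha b hb => (h i a ha b hb).2⟩,
      fun h i a ha b hb => ⟨h.1 i a ha b hb, h.2 i a ha b hb⟩⟩
  rw [IsPrimitive, IsTailless, not_hasBacktracking_iff, not_hasBacktracking_iff,
    isChain_multiple_two_iff, h1, IsClosedPath]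
  constructor
  · rintro ⟨⟨h0, h1⟩, -, h3, h4⟩
    refine ⟨h0, ⟨h1, h3⟩, (minimalPeriod_unroll_eq_length_iff h0).2 fun m b hm e => ?_⟩
    have hm0 : m ≠ 0 := by omega
    refine h4 ⟨m, b, hm, ⟨?_, ?_⟩, e⟩
    · rintro rfl
      simp [multiple] at e
      exact h0 e
    · rwa [e, cycle_chain_multiple_iff hm0] at h1
  · rintro ⟨h0, ⟨h1, h3⟩, h4⟩
    refine ⟨⟨h0, h1⟩, ?_, h3, ?_⟩
    · rw [← isChain_multiple_two_iff, multiple_succ, multiple_one] at h3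
      exact h3.left_of_append
    · rintro ⟨m, b, hm, -, e⟩
      exact (minimalPeriod_unroll_eq_length_iff h0).1 h4 m b hm e

theorem IsPrimitive.rotate {S : StepRule α} {l : List α} (h : S.IsPrimitive l) (k : ℕ) :
    S.IsPrimitive (l.rotate k) := by
  rw [isPrimitive_iff] at h ⊢
  obtain ⟨h0, h1, h2⟩ := h
  have e : ((l.rotate k : List α) : Cycle α) = l := Cycle.coe_eq_coe.2 ⟨l.length - k % l.length, by
    rw [← List.rotate_mod l k, List.rotate_rotate]
    have := Nat.mod_lt k (List.length_pos_of_ne_nil h0)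
    rw [Nat.add_sub_cancel' this.le, List.rotate_length]⟩
  refine ⟨by simpa using h0, by rwa [e], ?_⟩
  rw [unroll_rotate, minimalPeriod_apply_iterate (unroll_mem_periodicPts h0), h2,
    List.length_rotate]

/-- A primitive cycle of length `d` has exactly `d` different starting points. -/
theorem card_isPrimitive_of_primeCycle (c : S.PrimeCycle) :
    Nat.card {l : List α // S.IsPrimitive l ∧ (l : Cycle α) = c.1} = c.length := by
  obtain ⟨_, l, hl, rfl⟩ := c
  have h := (isPrimitive_iff S l).1 hl
  have hlen : PrimeCycle.length (S := S) ⟨(l : Cycle α), l, hl, rfl⟩ = l.length := rfl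
  rw [hlen, ← Nat.card_fin l.length]
  symm
  refine Nat.card_congr (Equiv.ofBijective (fun k : Fin l.length =>
    ⟨l.rotate k, hl.rotate k, Cycle.coe_eq_coe.2 (List.IsRotated.symm ⟨k, rfl⟩)⟩) ⟨?_, ?_⟩)
  · intro i j hij
    have e : l.rotate i = l.rotate j := congrArg Subtype.val hij
    have e2 := congrArg unroll e
    rw [unroll_rotate, unroll_rotate] at e2
    exact Fin.ext ((iterate_eq_iterate_iff_of_lt_minimalPeriod (by rw [h.2.2]; exact i.2)
      (by rw [h.2.2]; exact j.2)).1 e2)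
  · rintro ⟨l', hl', e⟩
    obtain ⟨k, hk⟩ := Cycle.coe_eq_coe.1 e.symm
    refine ⟨⟨k % l.length, Nat.mod_lt _ (List.length_pos_of_ne_nil h.1)⟩, Subtype.ext ?_⟩
    simpa [List.rotate_mod] using hk

/-- The non-empty words along which successive steps, read cyclically, do not backtrack. -/
abbrev ClosedWord : Type _ := {l : List α // l ≠ [] ∧ (l : Cycle α).Chain S.Next}

/-- Every closed word is uniquely a positive multiple of a primitive one. -/
theorem bijective_multiple : Function.Bijective
    (fun x : {l : List α // S.IsPrimitive l} × ℕ =>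
      (⟨multiple (x.2 + 1) x.1.1, by
        have h := (isPrimitive_iff S x.1.1).1 x.1.2
        refine ⟨fun h0 => h.1 ?_, (cycle_chain_multiple_iff (Nat.succ_ne_zero _)).2 h.2.1⟩
        simpa [multiple] using h0⟩ : S.ClosedWord)) := by
  constructor
  · rintro ⟨⟨l, hl⟩, k⟩ ⟨⟨l', hl'⟩, k'⟩ h
    have e : multiple (k + 1) l = multiple (k' + 1) l' := congrArg Subtype.val h
    rw [isPrimitive_iff] at hl hl'
    have e1 := congrArg unroll e
    rw [unroll_multiple (Nat.succ_ne_zero _), unroll_multiple (Nat.succ_ne_zero _)] at e1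
    have e2 : l.length = l'.length := by rw [← hl.2.2, ← hl'.2.2, e1]
    have e3 := eq_of_unroll_eq e1 e2
    subst e3
    have e4 := congrArg List.length e
    rw [length_multiple, length_multiple] at e4
    have := Nat.eq_of_mul_eq_mul_right (List.length_pos_of_ne_nil hl.1) e4
    simp at this
    simp [this]
  · rintro ⟨l, h0, h1⟩
    obtain ⟨k, hk⟩ := (isPeriodicPt_unroll l).minimalPeriod_dvd
    rw [mul_comm] at hk
    have hper := isPeriodicPt_minimalPeriod shift (unroll l)
    set d := minimalPeriod shift (unroll l) with hd
    have e := eq_multiple_take h0 hper hk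
    have hk0 : k ≠ 0 := by rintro rfl; simp at hk; exact h0 hk
    have hd0 : d ≠ 0 := by intro h; simp [h] at hk; exact h0 hk
    have hle : d ≤ l.length := hk ▸ Nat.le_mul_of_pos_left d (Nat.pos_of_ne_zero hk0)
    refine ⟨⟨⟨l.take d, (isPrimitive_iff S _).2 ⟨?_, ?_, ?_⟩⟩, k - 1⟩, Subtype.ext ?_⟩
    · simp [hd0, h0]
    · rwa [e, cycle_chain_multiple_iff hk0] at h1
    · rw [← unroll_multiple hk0 (l.take d), ← e, ← hd]
      simp [hle]
    · simp only
      rw [Nat.sub_add_cancel (Nat.pos_of_ne_zero hk0), ← e]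

end StepRule

end Words

/-! ### Counting closed words -/

namespace StepRule

variable {α : Type*} (S : StepRule α)

open Classical in
/-- The transfer matrix: its entry at `(a, b)` is `1` if `b` may follow `a` without backtracking,
and `0` otherwise. -/
noncomputable def transfer : Matrix α α ℂ := fun a b => if S.Next a b then 1 else 0

end StepRule

section Counting

variable {α : Type*} [Fintype α]

instance finite_list_length (n : ℕ) (P : List α → Prop) :
    Finite {l : List α // l.length = n ∧ P l} :=
  ((List.finite_length_eq α n).subset fun _ h => h.1).to_subtype

theorem card_list_length_succ (n : ℕ) (P : List α → Prop) :
    Nat.card {l : List α // l.length = n + 1 ∧ P l} =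
      ∑ a, Nat.card {l : List α // l.length = n ∧ P (a :: l)} := by
  rw [← Nat.card_sigma]
  refine Nat.card_congr (Equiv.ofBijective
    (fun x : Σ a, {l : List α // l.length = n ∧ P (a :: l)} =>
      (⟨x.1 :: x.2.1, by simp [x.2.2.1], x.2.2.2⟩ : {l : List α // l.length = n + 1 ∧ P l}))
    ⟨?_, ?_⟩).symm
  · rintro ⟨a, l, hl⟩ ⟨a', l', hl'⟩ h
    obtain ⟨rfl, rfl⟩ : a = a' ∧ l = l' := by simpa using h
    rfl
  · rintro ⟨_ | ⟨a, l⟩, hl, hP⟩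
    · simp at hl
    · exact ⟨⟨a, l, by simpa using hl, hP⟩, rfl⟩

variable (S : StepRule α) [DecidableEq α]

/-- Powers of the transfer matrix count walks with prescribed ends. -/
theorem card_walks (n : ℕ) (a b : α) :
    (Nat.card {l : List α // l.length = n ∧ List.IsChain S.Next (a :: (l ++ [b]))} : ℂ) =
      (S.transfer ^ (n + 1)) a b := by
  induction n generalizing a with
  | zero =>
    rw [zero_add, pow_one, StepRule.transfer]
    have e : ∀ l : List α, (l.length = 0 ∧ List.IsChain S.Next (a :: (l ++ [b]))) ↔
        (l = [] ∧ S.Next a b) := by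
      intro l
      rw [List.length_eq_zero_iff]
      refine and_congr_right ?_
      rintro rfl
      simp
    simp_rw [e]
    split_ifs with h <;> simp [h]
  | succ n ih =>
    rw [card_list_length_succ, pow_succ', Matrix.mul_apply, Nat.cast_sum]
    refine Finset.sum_congr rfl fun c _ => ?_
    rw [← ih, StepRule.transfer]
    simp only [List.cons_append, List.isChain_cons_cons (a := a)]
    split_ifs with h <;> simp [h]

theorem card_closedWord (n : ℕ) :
    (Nat.card {l : S.ClosedWord // l.1.length = n + 1} : ℂ) = (S.transfer ^ (n + 1)).trace := by
  have e : Nat.card {l : S.ClosedWord // l.1.length = n + 1} =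
      Nat.card {l : List α // l.length = n + 1 ∧ l ≠ [] ∧ (l : Cycle α).Chain S.Next} :=
    Nat.card_congr ⟨fun l => ⟨l.1.1, l.2, l.1.2⟩, fun l => ⟨⟨l.1, l.2.2⟩, l.2.1⟩,
      fun _ => rfl, fun _ => rfl⟩
  rw [e, card_list_length_succ, Nat.cast_sum, Matrix.trace]
  refine Finset.sum_congr rfl fun a _ => ?_
  rw [Matrix.diag_apply, ← card_walks]
  simp

end Counting

/-! ### The Euler product as a determinant -/

section EulerProduct

open Complex

/-- Summation over the fibres of a map with finite fibres. -/
theorem hasSum_card_fiber_mul {X ι : Type*} (f : X → ι) (hf : ∀ i, Finite {x // f x = i})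
    {g : ι → ℂ} {a : ℂ} (h : HasSum (fun x => g (f x)) a) :
    HasSum (fun i => Nat.card {x // f x = i} * g i) a := by
  rw [← (Equiv.sigmaFiberEquiv f).hasSum_iff] at h
  refine h.sigma fun i => ?_
  have := Fintype.ofFinite {x // f x = i}
  have h1 : ∀ c : {x // f x = i}, g (f c.1) = g i := fun c => by rw [c.2]
  simp only [Function.comp_apply, Equiv.sigmaFiberEquiv_apply, h1]
  convert hasSum_fintype (fun _ : {x // f x = i} => g i) using 1
  simp

theorem summable_pow_length {α : Type*} [Fintype α] {x : ℝ} (h0 : 0 ≤ x)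
    (h1 : Fintype.card α * x < 1) : Summable (fun l : List α => x ^ l.length) := by
  rw [← (Equiv.sigmaFiberEquiv (List.length (α := α))).summable_iff]
  have hfin : ∀ n, Fintype {l : List α // l.length = n} := fun n =>
    (List.finite_length_eq α n).fintype
  rw [summable_sigma_of_nonneg fun _ => by simp; positivity]
  refine ⟨fun n => Summable.of_finite, ?_⟩
  convert summable_geometric_of_lt_one (by positivity) h1 using 1
  funext n
  have h2 : ∀ l : {l : List α // l.length = n}, x ^ l.1.length = x ^ n := fun l => by rw [l.2]
  simp only [Function.comp_apply, Equiv.sigmaFiberEquiv_apply, h2]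
  rw [tsum_fintype, Finset.sum_const, Finset.card_univ, nsmul_eq_mul, mul_pow]
  have h3 : Fintype.card {l : List α // l.length = n} = Fintype.card α ^ n := by
    rw [← card_vector]
    exact Fintype.card_congr (Equiv.refl _)
  rw [h3]
  push_cast
  rfl

theorem hasSum_powerSum_log (s : Multiset ℂ) (u : ℂ) (h : ∀ x ∈ s, ‖u * x‖ < 1) :
    HasSum (fun n : ℕ => (s.map (fun x => x ^ n)).sum * (u ^ n / n))
      (s.map fun x => -log (1 - u * x)).sum := by
  induction s using Multiset.induction with
  | empty => simp
  | cons a s ih =>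
    have h1 := hasSum_taylorSeries_neg_log (h a (Multiset.mem_cons_self _ _))
    have h2 := ih fun x hx => h x (Multiset.mem_cons_of_mem hx)
    convert! h1.add h2 using 1
    · funext n
      simp only [Multiset.map_cons, Multiset.sum_cons, mul_pow]
      ring
    · simp

variable {α : Type*} (S : StepRule α)

/-- The term attached to a closed word `l`; summing it by length gives the traces of powers of
the transfer matrix, summing it over the multiples of primitive words the logarithm of the
Euler product. -/
noncomputable def wordWeight (u : ℂ) (l : S.ClosedWord) : ℂ := u ^ l.1.length / l.1.length

variable {S}

theorem summable_wordWeight [Fintype α] {u : ℂ} (h : Fintype.card α * ‖u‖ < 1) :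
    Summable (wordWeight S u) := by
  refine Summable.of_norm_bounded
    ((summable_pow_length (norm_nonneg u) h).comp_injective Subtype.val_injective) fun l => ?_
  rw [wordWeight, norm_div, norm_pow, norm_natCast]
  refine div_le_self (by positivity) ?_
  exact_mod_cast List.length_pos_of_ne_nil l.2.1

/-- Summation by length: the number of closed words of length `n` is the `n`-th power sum of the
eigenvalues of the transfer matrix. -/
theorem exp_neg_of_hasSum_wordWeight [Fintype α] [DecidableEq α] {u A : ℂ}
    (hu : ∀ x ∈ S.transfer.charpoly.roots, ‖u * x‖ < 1) (hA : HasSum (wordWeight S u) A) :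
    exp (-A) = S.transfer.charpolyRev.eval u := by
  have hfin : ∀ n, Finite {l : S.ClosedWord // l.1.length = n} := fun n =>
    Finite.of_injective
      (β := {l : List α // l.length = n ∧ l ≠ [] ∧ (l : Cycle α).Chain S.Next})
      (fun l => ⟨l.1.1, l.2, l.1.2⟩)
      fun l l' h => Subtype.ext (Subtype.ext (by simpa using h))
  have h1 := hasSum_card_fiber_mul (fun l : S.ClosedWord => l.1.length) hfin
    (g := fun n => u ^ n / n) hA
  have h2 : (fun n : ℕ => (Nat.card {l : S.ClosedWord // l.1.length = n} : ℂ) * (u ^ n / n)) =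
      fun n : ℕ => (S.transfer.charpoly.roots.map (fun x => x ^ n)).sum * (u ^ n / n) := by
    funext n
    rcases n with _ | n
    · -- At `n = 0` both sides vanish, since `u ^ 0 / 0 = 0`.
      simp
    · rw [card_closedWord, trace_pow_eq_sum_roots]
  rw [h2] at h1
  rw [h1.unique (hasSum_powerSum_log _ u hu), eval_charpolyRev_eq_prod_roots,
    Multiset.sum_map_neg, neg_neg, exp_multiset_sum, Multiset.map_map]
  refine congrArg Multiset.prod (Multiset.map_congr rfl fun x hx => ?_)
  refine exp_log fun h0 => ?_
  have := hu x hx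
  rw [← sub_eq_zero.1 h0] at this
  simp at this

theorem StepRule.PrimeCycle.length_pos (c : S.PrimeCycle) : 0 < c.length := by
  obtain ⟨_, l, hl, rfl⟩ := c
  exact List.length_pos_of_ne_nil hl.1.1

/-- Summation by primitive roots: the multiples of a primitive word `p` of length `d` contribute
`-log (1 - u ^ d) / d`, and each prime cycle of length `d` comes from `d` primitive words. -/
theorem hasSum_neg_log_of_hasSum_wordWeight {u A : ℂ} (hu : ‖u‖ < 1)
    (hA : HasSum (wordWeight S u) A) :
    HasSum (fun c : S.PrimeCycle => -log (1 - u ^ c.length)) A := by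
  rw [← (Equiv.ofBijective _ S.bijective_multiple).hasSum_iff] at hA
  have hlt : ∀ n : ℕ, 0 < n → ‖u ^ n‖ < 1 := fun n hn => by
    rw [norm_pow]
    exact pow_lt_one₀ (norm_nonneg _) hu hn.ne'
  have h1 : HasSum (fun p : {l : List α // S.IsPrimitive l} =>
      -log (1 - u ^ p.1.length) / p.1.length) A := by
    refine hA.prod_fiberwise fun p => ?_
    have hp := List.length_pos_of_ne_nil p.2.1.1
    have h := (hasSum_taylorSeries_neg_log' (hlt _ hp)).div_const (p.1.length : ℂ)
    convert! h using 1
    funext k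
    simp only [Function.comp_apply, Equiv.ofBijective_apply, wordWeight, length_multiple]
    rw [mul_comm, pow_mul, div_div]
    push_cast
    ring
  let q : {l : List α // S.IsPrimitive l} → S.PrimeCycle := fun p =>
    ⟨(p.1 : Cycle α), p.1, p.2, rfl⟩
  have hcard : ∀ c : S.PrimeCycle, Nat.card {p // q p = c} = c.length := fun c => by
    rw [← S.card_isPrimitive_of_primeCycle c]
    exact Nat.card_congr ⟨fun p => ⟨p.1.1, p.1.2, congrArg Subtype.val p.2⟩,
      fun l => ⟨⟨l.1, l.2.1⟩, Subtype.ext l.2.2⟩, fun _ => rfl, fun _ => rfl⟩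
  have h2 := hasSum_card_fiber_mul q
    (fun c => Nat.finite_of_card_ne_zero (by rw [hcard]; exact c.length_pos.ne'))
    (g := fun c => -log (1 - u ^ c.length) / c.length) h1
  convert! h2 using 1
  funext c
  rw [hcard, mul_div_cancel₀]
  exact_mod_cast c.length_pos.ne'

/-- The determinant formula: the inverse zeta function of a finite step rule is the reversed
characteristic polynomial `det (1 - uT)` of its transfer matrix. -/
theorem StepRule.invZetaIs_charpolyRev [Fintype α] [DecidableEq α] (S : StepRule α) :
    S.InvZetaIs S.transfer.charpolyRev := by
  set s := S.transfer.charpoly.roots.map norm with hs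
  have hs0 : ∀ x ∈ s, 0 ≤ x := by
    intro x hx
    obtain ⟨y, -, rfl⟩ := Multiset.mem_map.1 hx
    exact norm_nonneg y
  have hsum := Multiset.sum_nonneg hs0
  -- The radius makes the word sum converge and keeps `u` and all `λu` inside the unit disc.
  have hD : 0 < 1 + Fintype.card α + s.sum := by positivity
  refine ⟨(1 + Fintype.card α + s.sum)⁻¹, inv_pos.2 hD, fun u hu => ?_⟩
  have hbound : ∀ x : ℝ, 0 ≤ x → x < 1 + Fintype.card α + s.sum → x * ‖u‖ < 1 := by
    intro x hx0 hx
    calc x * ‖u‖ ≤ x * (1 + Fintype.card α + s.sum)⁻¹ := by gcongr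
      _ < 1 := by rw [← div_eq_mul_inv, div_lt_one hD]; exact hx
  have hu1 : ‖u‖ < 1 := by
    rcases eq_or_lt_of_le (show (0 : ℝ) ≤ Fintype.card α + s.sum by positivity) with h | h
    · have : (1 + Fintype.card α + s.sum : ℝ)⁻¹ = 1 := by rw [add_assoc, ← h]; simp
      rwa [this] at hu
    · simpa using hbound 1 zero_le_one (by linarith)
  obtain ⟨A, hA⟩ := summable_wordWeight (S := S) (hbound _ (Nat.cast_nonneg _) (by linarith))
  have hdet : exp (-A) = S.transfer.charpolyRev.eval u := by
    refine exp_neg_of_hasSum_wordWeight (fun x hx => ?_) hA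
    rw [norm_mul, mul_comm]
    have := Multiset.single_le_sum hs0 _ (Multiset.mem_map_of_mem norm hx)
    exact hbound _ (norm_nonneg _) (by linarith [(Nat.cast_nonneg _ : (0 : ℝ) ≤ Fintype.card α)])
  have hlog := hasSum_neg_log_of_hasSum_wordWeight hu1 hA
  have hre : ∀ c : S.PrimeCycle, 0 < (1 - u ^ c.length).re := fun c => by
    have h1 : ‖u ^ c.length‖ < 1 := by
      rw [norm_pow]
      exact pow_lt_one₀ (norm_nonneg _) hu1 c.length_pos.ne'
    have := (re_le_norm (u ^ c.length)).trans_lt h1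
    simpa using this
  have hne : ∀ c : S.PrimeCycle, (1 - u ^ c.length)⁻¹ ≠ 0 := fun c =>
    inv_ne_zero fun h => by simpa [h] using hre c
  have hprod : HasProd (fun c : S.PrimeCycle => (1 - u ^ c.length)⁻¹) (exp A) := by
    refine hasProd_of_hasSum_log hne ?_
    convert! hlog using 1
    funext c
    -- `log` commutes with inversion away from the negative real axis.
    refine log_inv _ fun h => ?_
    have := abs_arg_lt_pi_div_two_iff.2 (Or.inl (hre c))
    rw [h, abs_of_pos Real.pi_pos] at this
    linarith [Real.pi_pos]
  have hz : S.zeta u = exp A := hprod.tprod_eq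
  exact ⟨hprod.multipliable, by rw [hz]; exact exp_ne_zero A, by rw [hz, ← exp_neg, hdet]⟩

/-- Two polynomials that are inverse to zeta functions agreeing near `0` agree on a disc, hence are
equal. -/
theorem StepRule.InvZetaIs.eq_of_zeta_eq {β : Type*} {S' : StepRule β} {p q : ℂ[X]}
    (hp : S.InvZetaIs p) (hq : S'.InvZetaIs q) {r : ℝ} (hr : 0 < r)
    (h : ∀ u : ℂ, ‖u‖ < r → S.zeta u = S'.zeta u) : p = q := by
  obtain ⟨r₁, hr₁, hp⟩ := hp
  obtain ⟨r₂, hr₂, hq⟩ := hq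
  refine Polynomial.eq_of_infinite_eval_eq p q
    ((infinite_of_mem_nhds (0 : ℂ) (Metric.ball_mem_nhds 0 (lt_min hr (lt_min hr₁ hr₂)))).mono
      fun u hu => ?_)
  rw [mem_ball_zero_iff, lt_min_iff, lt_min_iff] at hu
  rw [Set.mem_ofPred_eq, ← (hp u hu.2.1).2.2, ← (hq u hu.2.2).2.2, h u hu.1]

theorem StepRule.InvZetaIs.unique {p q : ℂ[X]} (hp : S.InvZetaIs p) (hq : S.InvZetaIs q) : p = q :=
  hp.eq_of_zeta_eq hq one_pos fun _ _ => rfl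

end EulerProduct

/-! ### Nondegenerate transfer matrices -/

section Others

open Matrix

variable {ι κ : Type*}

open Classical in
/-- For a labelling `k`, the block diagonal matrix whose blocks, one for each label, are all-ones
matrices minus the identity. -/
noncomputable def others (k : ι → κ) : Matrix ι ι ℂ := fun a b => if k b = k a ∧ b ≠ a then 1 else 0

/-- The all-ones matrix minus the identity is singular only in size one. -/
theorem eq_zero_of_others_mulVec_eq_zero [Fintype ι] {k : ι → κ}
    (hk : ∀ a, ∃ b, b ≠ a ∧ k b = k a) {x : ι → ℂ} (hx : others k *ᵥ x = 0) : x = 0 := by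
  classical
  have hx' : ∀ a, ∑ b with k b = k a ∧ b ≠ a, x b = 0 := fun a => by
    have := congrFun hx a
    simpa [mulVec, dotProduct, others, Finset.sum_filter] using this
  have h1 : ∀ a, ∑ b with k b = k a, x b = x a := fun a => by
    rw [← Finset.sum_filter_add_sum_filter_not _ (fun b => b ≠ a), Finset.filter_filter, hx' a,
      zero_add, Finset.filter_filter]
    have : (Finset.univ.filter fun b => k b = k a ∧ ¬ b ≠ a) = {a} := by
      ext b
      simp +contextual
    rw [this, Finset.sum_singleton]
  -- Hence `x` is constant on each block, and its sum over the other members of a block vanishes.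
  have h2 : ∀ a b, k b = k a → x b = x a := fun a b h => by rw [← h1 a, ← h1 b, h]
  funext a
  have h3 := hx' a
  rw [Finset.sum_congr rfl fun b hb => h2 a b (Finset.mem_filter.1 hb).2.1, Finset.sum_const,
    nsmul_eq_mul, mul_eq_zero] at h3
  refine h3.resolve_left fun h0 => ?_
  obtain ⟨b, hb, hb'⟩ := hk a
  have := Finset.card_eq_zero.1 (Nat.cast_eq_zero.1 h0)
  exact Finset.notMem_empty b (this ▸ Finset.mem_filter.2 ⟨Finset.mem_univ b, hb', hb⟩)

end Others

/-! ### Graphs -/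

section Graphs

open Matrix

section EdgeMatrix

variable {β κ : Type*} [DecidableEq β]

open Classical in
/-- The transfer matrix of the subgraph with edge set `F`, where the oriented edge `a` has origin
`o a` and inverse `(a.1, !a.2)`. It is indexed by the oriented edges of the whole graph, those
outside `F` having zero rows and columns. -/
noncomputable def edgeMatrix (o : β × Bool → κ) (F : Finset β) : Matrix (β × Bool) (β × Bool) ℂ :=
  fun a b => if a.1 ∈ F ∧ b.1 ∈ F ∧ o (a.1, !a.2) = o b ∧ b ≠ (a.1, !a.2) then 1 else 0

variable [Fintype β]

theorem natDegree_charpolyRev_edgeMatrix (o : β × Bool → κ) (F : Finset β)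
    (h : ∀ a : β × Bool, a.1 ∈ F → ∃ b : β × Bool, b.1 ∈ F ∧ b ≠ a ∧ o b = o a) :
    (edgeMatrix o F).charpolyRev.natDegree = 2 * F.card := by
  rw [charpolyRev_of_rows_eq_zero (edgeMatrix o F) (fun a : β × Bool => a.1 ∈ F)
      (fun i hi j => if_neg fun hij => hi hij.1),
    natDegree_charpolyRev_of_mulVec_injective]
  · rw [Fintype.card_subtype]
    have : (Finset.univ.filter fun a : β × Bool => a.1 ∈ F) = F ×ˢ Finset.univ := by
      ext a
      simp
    rw [this, Finset.card_product, Finset.card_univ, Fintype.card_bool, mul_comm]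
  · intro x hx
    refine eq_zero_of_others_mulVec_eq_zero
      (k := fun a : {a : β × Bool // a.1 ∈ F} => o a.1) (fun a => ?_) ?_
    · obtain ⟨b, hb, hne, ho⟩ := h a.1 a.2
      exact ⟨⟨b, hb⟩, fun e => hne (congrArg Subtype.val e), ho⟩
    · -- Up to the permutation of the rows by inversion, the two matrices agree.
      funext a
      have := congrFun hx ⟨(a.1.1, !a.1.2), a.2⟩
      refine Eq.trans ?_ this
      refine Finset.sum_congr rfl fun b _ => ?_
      congr 1
      change others _ a b = edgeMatrix o F (a.1.1, !a.1.2) b.1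
      unfold others edgeMatrix
      congr 1
      simp [a.2, b.2, Subtype.ext_iff, eq_comm]

/-- Removing an edge with an end of degree one does not change `det (1 - uT)`. -/
theorem charpolyRev_edgeMatrix_erase (o : β × Bool → κ) (F : Finset β) (a : β × Bool)
    (h : ∀ b : β × Bool, b.1 ∈ F → o b = o a → b = a) :
    (edgeMatrix o F).charpolyRev = (edgeMatrix o (F.erase a.1)).charpolyRev := by
  -- No step follows the inverse of `a`, and `a` follows no step.
  have hrow : ∀ j, edgeMatrix o F (a.1, !a.2) j = 0 := fun j => if_neg fun hj => by
    simp only [Bool.not_not] at hj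
    exact hj.2.2.2 (h j hj.2.1 hj.2.2.1.symm)
  have hcol : ∀ i, edgeMatrix o F i a = 0 := fun i => if_neg fun hi =>
    hi.2.2.2 (h (i.1, !i.2) hi.1 hi.2.2.1).symm
  let B : Matrix (β × Bool) (β × Bool) ℂ := fun i j =>
    if j = (a.1, !a.2) then 0 else edgeMatrix o F i j
  have hor : ∀ i : β × Bool, i.1 = a.1 → i = a ∨ i = (a.1, !a.2) := by
    rintro ⟨e, s⟩ rfl
    rcases a with ⟨e, t⟩
    cases s <;> cases t <;> simp
  have h1 : (edgeMatrix o F).charpolyRev = B.charpolyRev := by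
    refine charpolyRev_congr_rows (fun i => i ≠ (a.1, !a.2)) ?_ ?_ ?_
    · intro i hi j
      rw [not_not.1 hi, hrow]
    · intro i hi j
      simp [B, not_not.1 hi, hrow]
    · intro i j _ hj
      simp [B, hj]
  rw [h1]
  refine charpolyRev_congr_cols (fun i => i.1 ≠ a.1) ?_ ?_ ?_
  · intro j hj i
    rcases hor j (not_not.1 hj) with rfl | rfl
    · simp [B, hcol]
    · simp [B]
  · intro j hj i
    simp [edgeMatrix, not_not.1 hj]
  · intro i j hi hj
    have hne : j ≠ (a.1, !a.2) := by
      rintro rfl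
      exact hj rfl
    refine (if_neg hne).trans ?_
    unfold edgeMatrix
    congr 1
    simp [hi, hj]

theorem even_natDegree_charpolyRev_edgeMatrix (o : β × Bool → κ) (F : Finset β) :
    Even (edgeMatrix o F).charpolyRev.natDegree := by
  induction F using Finset.strongInduction with
  | H F ih =>
    by_cases h : ∀ a : β × Bool, a.1 ∈ F → ∃ b : β × Bool, b.1 ∈ F ∧ b ≠ a ∧ o b = o a
    · rw [natDegree_charpolyRev_edgeMatrix o F h]
      exact even_two_mul _
    · push Not at h
      obtain ⟨a, ha, h⟩ := h
      rw [charpolyRev_edgeMatrix_erase o F a fun b hb ho => by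
        by_contra hne
        exact h b hb hne ho]
      exact ih _ (Finset.erase_ssubset ha)

end EdgeMatrix

variable {α β : Type*} (G : Graph α β)

theorem transfer_graphStepRule [Fintype G.edgeSet] [DecidableEq G.edgeSet] :
    (graphStepRule G).transfer =
      edgeMatrix (fun a => OrientedEdge.origin (G := G) a) Finset.univ := by
  ext a b
  have h : OrientedEdge.terminus (G := G) a = OrientedEdge.origin (G := G) (a.1, !a.2) := by
    rcases a with ⟨e, _ | _⟩ <;> rfl
  unfold StepRule.transfer edgeMatrix
  congr 1
  simp [StepRule.Next, graphStepRule, OrientedEdge.inverse, h]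

/-- A vertex that is the origin of a single oriented edge has degree one. -/
theorem graphDegree_origin_eq_one (a : OrientedEdge G)
    (h : ∀ b : OrientedEdge G, b.origin = a.origin → b = a) : graphDegree G a.origin = 1 := by
  have hlink : ∀ b : OrientedEdge G, G.IsLink b.1 b.origin b.terminus := by
    rintro ⟨e, _ | _⟩
    · exact (isLink_edgeOrigin_edgeTerminus G e).symm
    · exact isLink_edgeOrigin_edgeTerminus G e
  have hinc : {e : β | G.Inc e a.origin} = {a.1.1} := by
    ext e
    rw [Set.mem_singleton_iff]
    constructor
    · intro he
      have he' : G.Inc e a.origin := he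
      rcases he'.eq_or_eq_of_isLink (hlink (⟨e, he'.edge_mem⟩, true)) with h1 | h1
      · rw [← h _ h1.symm]
      · have h2 : OrientedEdge.origin (G := G) (⟨e, he'.edge_mem⟩, false) = a.origin := h1.symm
        rw [← h _ h2]
    · rintro rfl
      exact (hlink a).inc_left
  have hloop : G.loopSet a.origin = ∅ := by
    ext e
    simp only [Set.mem_empty_iff_false, iff_false]
    intro he
    have he' : G.IsLoopAt e a.origin := he
    have h1 : ∀ s : Bool, ((⟨e, he'.edge_mem⟩, s) : OrientedEdge G) = a := fun s =>
      h _ (he'.eq_of_inc (hlink (⟨e, he'.edge_mem⟩, s)).inc_left).symm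
    have h2 := (h1 true).trans (h1 false).symm
    simp at h2
  rw [graphDegree, hinc, hloop]
  simp

theorem even_natDegree_of_graph_invZetaIs (hE : G.edgeSet.Finite) {p : ℂ[X]}
    (hp : (graphStepRule G).InvZetaIs p) : Even p.natDegree := by
  classical
  have := hE.fintype
  rw [hp.unique (graphStepRule G).invZetaIs_charpolyRev, transfer_graphStepRule]
  exact even_natDegree_charpolyRev_edgeMatrix _ _

theorem exists_graph_invZetaIs (hE : G.edgeSet.Finite) :
    ∃ p, (graphStepRule G).InvZetaIs p := by
  classical
  have := hE.fintype
  exact ⟨_, (graphStepRule G).invZetaIs_charpolyRev⟩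

theorem natDegree_of_graph_invZetaIs (hE : G.edgeSet.Finite)
    (hdeg : ∀ v ∈ G.vertexSet, graphDegree G v ≠ 1) {p : ℂ[X]}
    (hp : (graphStepRule G).InvZetaIs p) : p.natDegree = 2 * G.edgeSet.ncard := by
  classical
  have := hE.fintype
  rw [hp.unique (graphStepRule G).invZetaIs_charpolyRev, transfer_graphStepRule,
    natDegree_charpolyRev_edgeMatrix, Finset.card_univ, Set.ncard_eq_toFinset_card',
    Set.toFinset_card]
  intro a _
  by_contra hcon
  push Not at hcon
  have hmem : OrientedEdge.origin (G := G) a ∈ G.vertexSet := by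
    rcases a with ⟨e, _ | _⟩
    · exact (isLink_edgeOrigin_edgeTerminus G e).right_mem
    · exact (isLink_edgeOrigin_edgeTerminus G e).left_mem
  refine hdeg _ hmem (graphDegree_origin_eq_one G a fun b hb => ?_)
  by_contra hne
  exact hcon b (Finset.mem_univ _) hne hb

end Graphs

/-! ### Hypergraphs -/

namespace MultiHypergraph

open Matrix

variable {V E : Type*} (H : MultiHypergraph V E)

/-- The incident pairs of a hypervertex and a hyperedge. -/
abbrev Flag : Type _ := {a : V × E // a.1 ∈ H.edge a.2}

theorem card_flag [Fintype V] [Fintype E] [Fintype H.Flag] :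
    Fintype.card H.Flag = ∑ e, (H.edge e).card := by
  rw [Fintype.card_congr (β := Σ e, H.edge e) ⟨fun a => ⟨a.1.2, a.1.1, a.2⟩,
    fun a => ⟨(a.2.1, a.1), a.2.2⟩, fun _ => rfl, fun _ => rfl⟩]
  simp

/-- On flags the transfer matrix is a product: a step first replaces the hypervertex of a flag by
another one of the same hyperedge, then the hyperedge by another one through the same
hypervertex. -/
theorem transfer_flag [Fintype V] [Fintype E] [Fintype H.Flag] :
    H.stepRule.transfer.toSquareBlockProp (fun a => a.1 ∈ H.edge a.2) =
      others (fun a : H.Flag => a.1.2) * others (fun a : H.Flag => a.1.1) := by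
  classical
  ext a b
  rw [Matrix.mul_apply]
  by_cases hba : b.1.1 ∈ H.edge a.1.2
  · rw [Finset.sum_eq_single ⟨(b.1.1, a.1.2), hba⟩]
    · obtain ⟨⟨v, e⟩, ha⟩ := a
      obtain ⟨⟨w, f⟩, hb⟩ := b
      simp only at ha hb hba
      by_cases h1 : v = w <;> by_cases h2 : e = f <;>
        simp [others, StepRule.transfer, StepRule.Next, stepRule, toSquareBlockProp, ha, hba, h1,
          h2, eq_comm]
    · intro c _ hc
      rw [others, others]
      split_ifs with h1 h2
      · exact (hc (Subtype.ext (Prod.ext h2.1.symm h1.1))).elim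
      all_goals simp
    · simp
  · rw [Finset.sum_eq_zero]
    · simp [StepRule.transfer, StepRule.Next, stepRule, toSquareBlockProp, hba]
    · intro c _
      rw [others, others]
      split_ifs with h1 h2
      · refine absurd ?_ hba
        rw [h2.1, ← h1.1]
        exact c.2
      all_goals simp

theorem natDegree_of_invZetaIs [Fintype V] [Fintype E] (hdeg : ∀ v, 2 ≤ H.degree v)
    (hcard : ∀ e, 2 ≤ (H.edge e).card) {p : ℂ[X]} (hp : H.stepRule.InvZetaIs p) :
    p.natDegree = ∑ e, (H.edge e).card := by
  classical
  rw [hp.unique H.stepRule.invZetaIs_charpolyRev,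
    charpolyRev_of_rows_eq_zero H.stepRule.transfer (fun a : V × E => a.1 ∈ H.edge a.2)
      (fun i hi j => if_neg fun hij => hi hij.1.1),
    natDegree_charpolyRev_of_mulVec_injective]
  · exact H.card_flag
  · intro x hx
    rw [transfer_flag, ← mulVec_mulVec] at hx
    refine eq_zero_of_others_mulVec_eq_zero ?_ (eq_zero_of_others_mulVec_eq_zero ?_ hx)
    · rintro ⟨⟨v, e⟩, ha⟩
      obtain ⟨f, hf, hne⟩ := Set.exists_ne_of_one_lt_ncard (hdeg v) e
      exact ⟨⟨(v, f), hf⟩, by simpa using hne, rfl⟩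
    · rintro ⟨⟨v, e⟩, ha⟩
      obtain ⟨w, hw, hne⟩ := Finset.exists_mem_ne (hcard e) v
      exact ⟨⟨(w, e), hw⟩, by simpa using hne, rfl⟩

theorem exists_invZetaIs [Fintype V] [Fintype E] : ∃ p, H.stepRule.InvZetaIs p := by
  classical
  exact ⟨_, H.stepRule.invZetaIs_charpolyRev⟩

end MultiHypergraph

end HypergraphZeta

theorem mainTheorem6 :
    -- the inverse zeta function of a finite graph without vertices of degree one
    (∀ {α β : Type*} (G : Graph α β), G.vertexSet.Finite → G.edgeSet.Finite →
      (∀ v ∈ G.vertexSet, graphDegree G v ≠ 1) →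
        (∃! p : ℂ[X], (graphStepRule G).InvZetaIs p) ∧
        ∀ p : ℂ[X], (graphStepRule G).InvZetaIs p → p.natDegree = 2 * G.edgeSet.ncard) ∧
    -- the inverse zeta function of a finite hypergraph
    (∀ {V E : Type*} [Fintype V] [Fintype E] (H : MultiHypergraph V E),
      (∀ v, 2 ≤ H.degree v) → (∀ e, 2 ≤ (H.edge e).card) →
        (∃! p : ℂ[X], H.stepRule.InvZetaIs p) ∧
        ∀ p : ℂ[X], H.stepRule.InvZetaIs p → p.natDegree = ∑ e, (H.edge e).card) ∧
    -- if the sum of the orders is odd, no finite graph has the zeta function of the hypergraph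
    (∀ {V E : Type*} [Fintype V] [Fintype E] (H : MultiHypergraph V E),
      (∀ v, 2 ≤ H.degree v) → (∀ e, 2 ≤ (H.edge e).card) →
      Odd (∑ e, (H.edge e).card) →
        ∀ {α β : Type*} (G : Graph α β), G.vertexSet.Finite → G.edgeSet.Finite →
          ¬ ∃ r : ℝ, 0 < r ∧ ∀ u : ℂ, ‖u‖ < r → H.zeta u = graphZeta G u) := by
  refine ⟨?_, ?_, ?_⟩
  · intro α β G _ hE hdeg
    obtain ⟨p, hp⟩ := exists_graph_invZetaIs G hE
    exact ⟨⟨p, hp, fun q hq => StepRule.InvZetaIs.unique hq hp⟩,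
      fun q hq => natDegree_of_graph_invZetaIs G hE hdeg hq⟩
  · intro V E _ _ H hdeg hcard
    obtain ⟨p, hp⟩ := H.exists_invZetaIs
    exact ⟨⟨p, hp, fun q hq => StepRule.InvZetaIs.unique hq hp⟩,
      fun q hq => H.natDegree_of_invZetaIs hdeg hcard hq⟩
  · rintro V E _ _ H hdeg hcard hodd α β G _ hE ⟨r, hr, h⟩
    obtain ⟨p, hp⟩ := H.exists_invZetaIs
    obtain ⟨q, hq⟩ := exists_graph_invZetaIs G hE
    have hpq : p = q := StepRule.InvZetaIs.eq_of_zeta_eq hp hq hr h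
    rw [← H.natDegree_of_invZetaIs hdeg hcard hp, hpq] at hodd
    exact Nat.not_even_iff_odd.2 hodd (even_natDegree_of_graph_invZetaIs G hE hq)
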